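/- Let $A$ be an invertible real $d\times d$ matrix that is expansive (all its complex eigenvalues have modulus greater than $1$) and satisfies $A\mathbb{Z}^d\subset\mathbb{Z}^d$. On $L^2(\mathbb{R}^d)$ put $T_af(x)=f(x-a)$, and for an invertible matrix $B$ put $D_Bf(x)=|\det B|^{1/2}f(Bx)$ and $\widetilde D_Bf(x)=|\det B|\,f(Bx)$. For $\Psi=\{\psi_1,\dots,\psi_n\}\subset L^2(\mathbb{R}^d)$ the quasi-affine system $\mathcal{U}^q_{A,I}(\Psi)$ is the family, indexed by $(j,m,z)\in\{1,\dots,n\}\times\mathbb{Z}\times\mathbb{Z}^d$, whose $(j,m,z)$ member is $D_{A^m}T_z\psi_j$ if $m\ge 0$ and $T_z\widetilde D_{A^m}\psi_j$ if $m<0$. Let $\Psi=\{\psi_1,\dots,\psi_n\}$ and $\Phi=\{\phi_1,\dots,\phi_n\}$ be such that $\mathcal{U}^q_{A,I}(\Psi)$ and $\mathcal{U}^q_{A,I}(\Phi)$ are both frames for $L^2(\mathbb{R}^d)$. With the Fourier transform $\hat f(\xi)=\int f(x)e^{-2\pi i\langle\xi,x\rangle}\,dx$ (extended to $L^2$), define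 $$m_j^0(\xi)=\sum_{k\in\mathbb{Z}^d}|\hat\psi_j(\xi+k)|^2,\qquad n_j^0(\xi)=\sum_{k\in\mathbb{Z}^d}|\hat\phi_j(\xi+k)|^2 .$$ Suppose that for every $j=1,\dots,n$ the supports of $m_j^0$ and $n_j^0$ are disjoint up to a null set, i.e. $\{\xi: m_j^0(\xi)\ne0\}\cap\{\xi: n_j^0(\xi)\neq 0\}$ has Lebesgue measure zero. Then the frames $\mathcal{U}^q_{A,I}(\Psi)=(x_p)_p$ and $\mathcal{U}^q_{A,I}(\Phi)=(y_p)_p$ are strongly disjoint: the ranges of their analysis operators $f\mapsto(\langle f,x_p\rangle)_p$ and $f\mapsto(\langle f,y_p\rangle)_p$ are orthogonal subspaces of $\ell^2(\{1,\dots,n\}\times\mathbb{Z}\times\mathbb{Z}^d)$. Also, there are frames $(x'_p)$ and $(y'_p)$ for $L^2(\mathbb{R}^d)$, similar to $(x_p)$ and $(y_p)$ respectively (that is, $x'_p=Sx_p$ and $y'_p=Ry_p$ for all $p$, with bounded invertible operators $S,R$), such that $(x'_p\oplus y'_p)_p$ is a frame for $L^2(\mathbb{R}^d)\oplus L^2(\mathbb{R}^d)$.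 -/

import Mathlib

open MeasureTheory

open scoped FourierTransform ENNReal

noncomputable section

namespace QuasiAffine

section Frames

variable {J H K : Type*} [NormedAddCommGroup H] [InnerProductSpace ℂ H]
  [NormedAddCommGroup K] [InnerProductSpace ℂ K]

/-- `x` is a Bessel sequence: `∑ j, |⟨u, x j⟩|² ≤ C ‖u‖²` for all `u`. -/
def IsBessel (x : J → H) : Prop :=
  ∃ C : ℝ, ∀ u : H, Summable (fun j => ‖inner ℂ (x j) u‖ ^ 2) ∧
    ∑' j, ‖inner ℂ (x j) u‖ ^ 2 ≤ C * ‖u‖ ^ 2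

/-- `x` is a frame for `H`:
`C₁ ‖u‖² ≤ ∑ j, |⟨u, x j⟩|² ≤ C₂ ‖u‖²` for all `u`, with `0 < C₁` and `C₂ < ∞`. -/
def IsFrame (x : J → H) : Prop :=
  ∃ C₁ C₂ : ℝ, 0 < C₁ ∧ ∀ u : H, Summable (fun j => ‖inner ℂ (x j) u‖ ^ 2) ∧
    C₁ * ‖u‖ ^ 2 ≤ ∑' j, ‖inner ℂ (x j) u‖ ^ 2 ∧
    ∑' j, ‖inner ℂ (x j) u‖ ^ 2 ≤ C₂ * ‖u‖ ^ 2

/-- The analysis operator `u ↦ (⟨u, x j⟩)_j` of a Bessel sequence, with values in `ℓ²(J)`.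
(Mathlib's inner product is linear in its second argument.) -/
def analysis (x : J → H) (hx : IsBessel x) : H →ₗ[ℂ] lp (fun _ : J => ℂ) 2 where
  toFun u := ⟨fun j => inner ℂ (x j) u, by
    obtain ⟨C, hC⟩ := hx
    refine memℓp_gen ?_
    simpa using (hC u).1⟩
  map_add' u v := by
    ext j
    exact inner_add_right _ _ _
  map_smul' c u := by
    ext j
    exact inner_smul_right _ _ _

/-- Strong disjointness: both sequences are Bessel, and the ranges of their analysis operators
are orthogonal subspaces of `ℓ²(J)`. -/
def StronglyDisjoint (x : J → H) (y : J → K) : Prop :=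
  ∃ (hx : IsBessel x) (hy : IsBessel y),
    LinearMap.range (analysis x hx) ⟂ LinearMap.range (analysis y hy)

/-- `x` and `y` are similar: a bounded invertible operator `S` maps `x j` to `y j`. -/
def Similar (x : J → H) (y : J → K) : Prop :=
  ∃ S : H ≃L[ℂ] K, ∀ j, S (x j) = y j

/-- There are frames `x'` of `H` and `y'` of `K`, similar to `x` and `y` respectively, such that
`x' j ⊕ y' j` is a frame for the Hilbert space direct sum `H ⊕ K`. -/
def HasDirectSumFrame (x : J → H) (y : J → K) : Prop :=
  ∃ (x' : J → H) (y' : J → K), IsFrame x' ∧ IsFrame y' ∧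
    IsFrame (fun j => (WithLp.toLp 2 (x' j, y' j) : WithLp 2 (H × K))) ∧
    Similar x x' ∧ Similar y y'

end Frames

variable {d n : ℕ}

/-- `L²(ℝᵈ)`, complex valued, with Lebesgue measure. -/
abbrev L2 (d : ℕ) : Type :=
  Lp ℂ 2 (volume : Measure (EuclideanSpace ℝ (Fin d)))

/-- The point of `ℝᵈ` with integer coordinates `z`. -/
def intVec (z : Fin d → ℤ) : EuclideanSpace ℝ (Fin d) :=
  WithLp.toLp 2 (fun i => (z i : ℝ))

/-- The translation `T_a f = f(· - a)` on `L²(ℝᵈ)`. -/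
def translation (a : EuclideanSpace ℝ (Fin d)) (f : L2 d) : L2 d :=
  Lp.compMeasurePreserving (fun x => x - a) (measurePreserving_sub_right volume a) f

theorem memLp_comp_matrix (A : GL (Fin d) ℝ) (f : L2 d) :
    MemLp (fun x => f (Matrix.toEuclideanLin (A : Matrix (Fin d) (Fin d) ℝ) x)) 2
      (volume : Measure (EuclideanSpace ℝ (Fin d))) := by
  set L := Matrix.toEuclideanLin (A : Matrix (Fin d) (Fin d) ℝ) with hL
  have hdet : LinearMap.det L ≠ 0 := by
    have h : LinearMap.det L = (A : Matrix (Fin d) (Fin d) ℝ).det := by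
      rw [hL, Matrix.toEuclideanLin, Matrix.toLpLin_eq_toLin, LinearMap.det_toLin]
    rw [h]
    exact (Matrix.isUnits_det_units A).ne_zero
  have hm : Measurable L := L.continuous_of_finiteDimensional.measurable
  have hmap := Measure.map_linearMap_addHaar_eq_smul_addHaar
    (volume : Measure (EuclideanSpace ℝ (Fin d))) hdet
  have hf : MemLp f 2 (Measure.map L (volume : Measure (EuclideanSpace ℝ (Fin d)))) := by
    rw [hmap]
    exact (Lp.memLp f).smul_measure ENNReal.ofReal_ne_top
  exact hf.comp_of_map hm.aemeasurable

/-- The composition `f(A ·)` on `L²(ℝᵈ)`, for an invertible matrix `A`. -/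
def compMatrix (A : GL (Fin d) ℝ) (f : L2 d) : L2 d :=
  (memLp_comp_matrix A f).toLp _

/-- The unitary dilation `D_A f = |det A|^{1/2} f(A ·)`. -/
def dilation (A : GL (Fin d) ℝ) (f : L2 d) : L2 d :=
  ((Real.sqrt |(A : Matrix (Fin d) (Fin d) ℝ).det| : ℝ) : ℂ) • compMatrix A f

/-- The `L¹`-normalized dilation `f ↦ |det A| f(A ·)`. -/
def dilationL1 (A : GL (Fin d) ℝ) (f : L2 d) : L2 d :=
  ((|(A : Matrix (Fin d) (Fin d) ℝ).det| : ℝ) : ℂ) • compMatrix A f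

/-- All (complex) eigenvalues of `A` have modulus greater than one. -/
def IsExpansive (A : GL (Fin d) ℝ) : Prop :=
  ∀ μ : ℂ, Module.End.HasEigenvalue
    (Matrix.toLin' ((A : Matrix (Fin d) (Fin d) ℝ).map (fun t : ℝ => (t : ℂ)))) μ → 1 < ‖μ‖

/-- `A` maps `ℤᵈ` into itself. -/
def PreservesIntegers (A : GL (Fin d) ℝ) : Prop :=
  ∀ z : Fin d → ℤ, ∃ w : Fin d → ℤ,
    Matrix.toEuclideanLin (A : Matrix (Fin d) (Fin d) ℝ) (intVec z) = intVec w

/-- The quasi-affine system with dilation `A`, integer translations and generators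
`Ψ 0, …, Ψ (n-1)`, indexed by generator `j`, scale `m` and translation `z`:
`D_{A^m} T_z ψ_j` for `m ≥ 0`, and `T_z D̃_{A^m} ψ_j` for `m < 0`, where `D̃` is the
`L¹`-normalized dilation. -/
def quasiAffine (A : GL (Fin d) ℝ) (Ψ : Fin n → L2 d) :
    Fin n × ℤ × (Fin d → ℤ) → L2 d :=
  fun p =>
    if 0 ≤ p.2.1 then dilation (A ^ p.2.1) (translation (intVec p.2.2) (Ψ p.1))
    else translation (intVec p.2.2) (dilationL1 (A ^ p.2.1) (Ψ p.1))

/-- The periodization `ξ ↦ ∑_{k ∈ ℤᵈ} |ψ̂(ξ + k)|²`, with values in `[0, ∞]`. The Fourier transform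
is the one on `L²(ℝᵈ)`, with kernel `exp(-2πi⟨ξ, x⟩)`. -/
def periodization (ψ : L2 d) (ξ : EuclideanSpace ℝ (Fin d)) : ℝ≥0∞ :=
  ∑' k : Fin d → ℤ, ‖(𝓕 ψ : L2 d) (ξ + intVec k)‖ₑ ^ 2

end QuasiAffine

end

/-! Orthogonality of the two ranges means that the mixed sum `∑ p, ⟨y_p, v⟩⟨u, x_p⟩` vanishes. By
absolute summability it may be summed over `z` for each generator `j` and scale `m`, and every such
level vanishes by itself.

At `m = 0`, the coefficients against integer translates are Fourier coefficients on the torus.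
Parseval turns the sum into the integral of a product whose factors live on the supports of the two
periodizations, hence zero (`stronglyDisjoint_translation`). For `m > 0` the dilation moves onto the
test vectors. For `m < 0`, `T_z` passes through the dilation as `T_{A^m z}`; splitting `ℤᵈ` into
cosets of `A^{-m}ℤᵈ` again leaves integer translates, up to a fixed shift
(`tsum_eq_zero_of_tsum_coset_eq_zero`). -/

noncomputable section

namespace QuasiAffine

open scoped ComplexConjugate

/-! ### Analysis operators, strong disjointness and direct sums -/

section Hilbert

variable {J H K : Type*} [NormedAddCommGroup H] [InnerProductSpace ℂ H]
  [NormedAddCommGroup K] [InnerProductSpace ℂ K]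

theorem IsFrame.isBessel {x : J → H} (hx : IsFrame x) : IsBessel x := by
  obtain ⟨_, C, _, h⟩ := hx
  exact ⟨C, fun u => ⟨(h u).1, (h u).2.2⟩⟩

theorem IsBessel.comp_injective {I : Type*} {x : J → H} (hx : IsBessel x) {e : I → J}
    (he : Function.Injective e) : IsBessel (x ∘ e) := by
  obtain ⟨C, h⟩ := hx
  refine ⟨C, fun u => ⟨(h u).1.comp_injective he, le_trans ?_ (h u).2⟩⟩
  exact tsum_comp_le_tsum_of_inj (h u).1 (fun _ => by positivity) he

@[simp]
theorem analysis_apply {x : J → H} (hx : IsBessel x) (u : H) (j : J) :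
    analysis x hx u j = inner ℂ (x j) u := rfl

theorem norm_analysis_sq {x : J → H} (hx : IsBessel x) (u : H) :
    ‖analysis x hx u‖ ^ 2 = ∑' j, ‖inner ℂ (x j) u‖ ^ 2 := by
  have h := lp.norm_rpow_eq_tsum (p := 2) (by norm_num) (analysis x hx u)
  simpa using h

/-- The analysis operator of a Bessel sequence, as a bounded operator. -/
def analysisCLM (x : J → H) (hx : IsBessel x) : H →L[ℂ] lp (fun _ : J => ℂ) 2 :=
  (analysis x hx).mkContinuous (Real.sqrt (max hx.choose 0)) fun u => by
    rw [← Real.sqrt_sq (norm_nonneg u), ← Real.sqrt_mul (le_max_right _ _)]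
    refine Real.le_sqrt_of_sq_le ?_
    rw [norm_analysis_sq]
    refine (hx.choose_spec u).2.trans ?_
    gcongr
    exact le_max_left _ _

@[simp]
theorem analysisCLM_apply {x : J → H} (hx : IsBessel x) (u : H) :
    analysisCLM x hx u = analysis x hx u := rfl

theorem inner_analysis {x : J → H} {y : J → K} (hx : IsBessel x) (hy : IsBessel y)
    (u : H) (v : K) :
    inner ℂ (analysis x hx u) (analysis y hy v) =
      ∑' j, inner ℂ (y j) v * inner ℂ u (x j) := by
  rw [lp.inner_eq_tsum]
  simp [RCLike.inner_apply]

theorem hasSum_inner_analysis {x : J → H} {y : J → K} (hx : IsBessel x) (hy : IsBessel y)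
    (u : H) (v : K) :
    HasSum (fun j => inner ℂ (y j) v * inner ℂ u (x j))
      (inner ℂ (analysis x hx u) (analysis y hy v)) := by
  simpa [RCLike.inner_apply] using lp.hasSum_inner (𝕜 := ℂ) (analysis x hx u) (analysis y hy v)

theorem stronglyDisjoint_of_tsum_eq_zero {x : J → H} {y : J → K} (hx : IsBessel x)
    (hy : IsBessel y) (h : ∀ u v, ∑' j, inner ℂ (y j) v * inner ℂ u (x j) = 0) :
    StronglyDisjoint x y := by
  refine ⟨hx, hy, ?_⟩
  rw [Submodule.isOrtho_iff_inner_eq]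
  rintro _ ⟨u, rfl⟩ _ ⟨v, rfl⟩
  rw [inner_analysis, h]

/-- The coefficients of `w` are the sum of two orthogonal sequences, so Pythagoras splits the frame
sum and the bounds combine by `min` and `max`. -/
theorem StronglyDisjoint.isFrame_toLp {x : J → H} {y : J → K} (h : StronglyDisjoint x y)
    (hx : IsFrame x) (hy : IsFrame y) :
    IsFrame (fun j => (WithLp.toLp 2 (x j, y j) : WithLp 2 (H × K))) := by
  obtain ⟨bx, bY, hxy⟩ := h
  obtain ⟨a₁, a₂, ha, hx⟩ := hx
  obtain ⟨b₁, b₂, hb, hy⟩ := hy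
  rw [Submodule.isOrtho_iff_inner_eq] at hxy
  refine ⟨min a₁ b₁, max a₂ b₂, lt_min ha hb, fun w => ?_⟩
  set θ := analysis x bx w.fst + analysis y bY w.snd with hθ
  have hin : ∀ j, ‖inner ℂ (WithLp.toLp 2 (x j, y j) : WithLp 2 (H × K)) w‖ ^ 2 =
      ‖θ j‖ ^ 2 := fun j => by
    simp [hθ, WithLp.prod_inner_apply]
  have hsum : HasSum (fun j => ‖θ j‖ ^ 2) (‖θ‖ ^ 2) := by
    simpa using lp.hasSum_norm (p := 2) (by norm_num) θ
  have hpyth : ‖θ‖ ^ 2 = ‖analysis x bx w.fst‖ ^ 2 + ‖analysis y bY w.snd‖ ^ 2 := by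
    have := norm_add_sq_eq_norm_sq_add_norm_sq_of_inner_eq_zero (𝕜 := ℂ) _ _
      (hxy _ ⟨w.fst, rfl⟩ _ ⟨w.snd, rfl⟩)
    simpa only [sq] using this
  have hw : ‖w‖ ^ 2 = ‖w.fst‖ ^ 2 + ‖w.snd‖ ^ 2 := WithLp.prod_norm_sq_eq_of_L2 w
  simp_rw [hin]
  refine ⟨hsum.summable, ?_, ?_⟩ <;> rw [hsum.tsum_eq, hpyth, hw, norm_analysis_sq,
    norm_analysis_sq, mul_add]
  · refine add_le_add (le_trans ?_ (hx _).2.1) (le_trans ?_ (hy _).2.1) <;> gcongr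
    exacts [min_le_left _ _, min_le_right _ _]
  · refine add_le_add ((hx _).2.2.trans ?_) ((hy _).2.2.trans ?_) <;> gcongr
    exacts [le_max_left _ _, le_max_right _ _]

theorem StronglyDisjoint.hasDirectSumFrame {x : J → H} {y : J → K} (h : StronglyDisjoint x y)
    (hx : IsFrame x) (hy : IsFrame y) : HasDirectSumFrame x y :=
  ⟨x, y, hx, hy, h.isFrame_toLp hx hy, ⟨.refl ℂ H, fun _ => rfl⟩, ⟨.refl ℂ K, fun _ => rfl⟩⟩

end Hilbert

/-! ### Integer translates and Fourier series on the torus -/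

section Fourier

variable {d : ℕ}

local instance : MeasureSpace UnitAddCircle := ⟨AddCircle.haarAddCircle⟩

local instance : IsProbabilityMeasure (volume : Measure UnitAddCircle) :=
  inferInstanceAs (IsProbabilityMeasure AddCircle.haarAddCircle)

/-- The translation of `L²(ℝᵈ)`, as a linear isometry. -/
def translationₗᵢ (a : EuclideanSpace ℝ (Fin d)) : L2 d →ₗᵢ[ℂ] L2 d :=
  Lp.compMeasurePreservingₗᵢ ℂ (fun x => x - a) (measurePreserving_sub_right volume a)

theorem translationₗᵢ_apply (a : EuclideanSpace ℝ (Fin d)) (f : L2 d) :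
    translationₗᵢ a f = translation a f := rfl

theorem coeFn_translation (a : EuclideanSpace ℝ (Fin d)) (f : L2 d) :
    translation a f =ᵐ[volume] fun x => f (x - a) :=
  Lp.coeFn_compMeasurePreserving f _

theorem translation_toLp (a : EuclideanSpace ℝ (Fin d))
    (f : SchwartzMap (EuclideanSpace ℝ (Fin d)) ℂ) :
    translation a (f.toLp 2) = (f.compSubConstCLM ℂ a).toLp 2 := by
  refine Lp.ext ?_
  have h := (measurePreserving_sub_right (volume : Measure (EuclideanSpace ℝ (Fin d)))
    a).quasiMeasurePreserving.ae_eq_comp (f.coeFn_toLp 2)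
  filter_upwards [coeFn_translation a (f.toLp 2), h,
    (f.compSubConstCLM ℂ a).coeFn_toLp 2] with x h₁ h₂ h₃
  rw [h₁, h₃]
  exact h₂

theorem fourier_compSubConstCLM (a ξ : EuclideanSpace ℝ (Fin d))
    (f : SchwartzMap (EuclideanSpace ℝ (Fin d)) ℂ) :
    𝓕 (f.compSubConstCLM ℂ a) ξ = 𝐞 (-inner ℝ a ξ) • 𝓕 f ξ := by
  have h := congrFun (VectorFourier.fourierIntegral_comp_add_right 𝐞 volume
    (innerₗ (EuclideanSpace ℝ (Fin d))) f (-a)) ξ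
  rw [SchwartzMap.fourier_coe, SchwartzMap.fourier_coe]
  simp only [Function.comp_def, ← sub_eq_add_neg, map_neg, LinearMap.neg_apply,
    innerₗ_apply_apply] at h
  exact h

/-- The right side is the pairing of `𝓕 f` with a modulated indicator. Both sides are thus
continuous in `f`, and it suffices to check Schwartz functions. -/
theorem inner_indicatorConstLp_fourier_translation {s : Set (EuclideanSpace ℝ (Fin d))}
    (hs : MeasurableSet s) (hμs : volume s ≠ ∞) (a : EuclideanSpace ℝ (Fin d)) (f : L2 d) :
    inner ℂ (indicatorConstLp 2 hs hμs (1 : ℂ)) (𝓕 (translation a f) : L2 d) =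
      ∫ ξ in s, 𝐞 (-inner ℝ a ξ) • (𝓕 f : L2 d) ξ := by
  have hmeas : Measurable fun ξ : EuclideanSpace ℝ (Fin d) => (𝐞 (inner ℝ a ξ) : ℂ) := by
    fun_prop
  have hmem : MemLp (s.indicator fun ξ => (𝐞 (inner ℝ a ξ) : ℂ)) 2
      (volume : Measure (EuclideanSpace ℝ (Fin d))) := by
    refine (memLp_indicator_const 2 hs (1 : ℂ) (Or.inr hμs)).of_le
      (hmeas.indicator hs).aestronglyMeasurable (.of_forall fun ξ => ?_)
    by_cases h : ξ ∈ s <;> simp [h, Circle.norm_coe]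
  have hinner : ∀ g : L2 d, inner ℂ (hmem.toLp _) g = ∫ ξ in s, 𝐞 (-inner ℝ a ξ) • g ξ := by
    intro g
    rw [L2.inner_def, ← integral_indicator hs]
    refine integral_congr_ae ?_
    filter_upwards [hmem.coeFn_toLp] with ξ hξ
    rw [hξ]
    by_cases h : ξ ∈ s
    · simp [h, RCLike.inner_apply, Circle.smul_def, mul_comm, AddChar.map_neg_eq_inv]
    · simp [h]
  rw [← hinner]
  refine DenseRange.induction_on
    (SchwartzMap.denseRange_toLpCLM (p := 2) (μ := volume) ENNReal.ofNat_ne_top) f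
    (isClosed_eq ?_ ?_) fun φ => ?_
  · exact (continuous_const.inner (((Lp.fourierTransformₗᵢ _ ℂ).continuous).comp
      (translationₗᵢ a).continuous))
  · exact (continuous_const.inner ((Lp.fourierTransformₗᵢ _ ℂ).continuous))
  · rw [hinner, SchwartzMap.toLpCLM_apply, translation_toLp, SchwartzMap.toLp_fourier_eq,
      SchwartzMap.toLp_fourier_eq, L2.inner_indicatorConstLp_one]
    refine setIntegral_congr_ae hs ?_
    filter_upwards [(𝓕 φ).coeFn_toLp 2, (𝓕 (φ.compSubConstCLM ℂ a)).coeFn_toLp 2]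
      with ξ h₁ h₂ _
    rw [h₁, h₂, fourier_compSubConstCLM]

/-- The half-open unit cube with lower corner `k`. -/
def unitCube (k : Fin d → ℤ) : Set (EuclideanSpace ℝ (Fin d)) :=
  {x | ∀ i, x i ∈ Set.Ioc (k i : ℝ) (k i + 1)}

theorem measurableSet_unitCube (k : Fin d → ℤ) : MeasurableSet (unitCube k) := by
  have : unitCube k = ⋂ i, (fun x : EuclideanSpace ℝ (Fin d) => x i) ⁻¹'
      Set.Ioc (k i : ℝ) (k i + 1) := by
    ext; simp [unitCube]
  rw [this]
  exact .iInter fun i => measurableSet_Ioc.preimage (by fun_prop)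

theorem iUnion_unitCube : ⋃ k : Fin d → ℤ, unitCube k = Set.univ := by
  -- The cubes are open below and closed above, hence `⌈x i⌉ - 1` rather than the floor.
  refine Set.eq_univ_of_forall fun x => Set.mem_iUnion.2 ⟨fun i => ⌈x i⌉ - 1, fun i => ?_⟩
  have h₁ := Int.ceil_lt_add_one (x i)
  have h₂ := Int.le_ceil (x i)
  push_cast
  constructor <;> linarith

theorem pairwise_disjoint_unitCube :
    Pairwise (Function.onFun Disjoint (unitCube (d := d))) := by
  intro k l hkl
  refine Set.disjoint_left.2 fun x hk hl => hkl (funext fun i => ?_)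
  have h₁ := hk i
  have h₂ := hl i
  have h₃ : (k i : ℝ) < l i + 1 := h₁.1.trans_le h₂.2
  have h₄ : (l i : ℝ) < k i + 1 := h₂.1.trans_le h₁.2
  norm_cast at h₃ h₄
  omega

/-- The section of the covering map `ℝᵈ → ℝᵈ / ℤᵈ` with values in `unitCube k`. -/
def torusLift (k : Fin d → ℤ) (t : UnitAddTorus (Fin d)) : EuclideanSpace ℝ (Fin d) :=
  WithLp.toLp 2 (UnitAddTorus.measurableEquivPiIoc (fun i => (k i : ℝ)) t).1

theorem coe_torusLift (k : Fin d → ℤ) (t : UnitAddTorus (Fin d)) (i : Fin d) :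
    ((torusLift k t i : ℝ) : UnitAddCircle) = t i :=
  congrFun ((UnitAddTorus.measurableEquivPiIoc (fun i => (k i : ℝ))).symm_apply_apply t) i

theorem exists_torusLift_eq_add (k l : Fin d → ℤ) (t : UnitAddTorus (Fin d)) :
    ∃ m : Fin d → ℤ, torusLift l t = torusLift k t + intVec m := by
  have h : ∀ i, ∃ m : ℤ, torusLift l t i = torusLift k t i + m := fun i => by
    have := (coe_torusLift l t i).trans (coe_torusLift k t i).symm
    rw [← sub_eq_zero, ← AddCircle.coe_sub, AddCircle.coe_eq_zero_iff] at this
    obtain ⟨m, hm⟩ := this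
    exact ⟨m, by simpa [eq_sub_iff_add_eq, add_comm, eq_comm] using hm⟩
  choose m hm using h
  exact ⟨m, by ext i; simpa [intVec] using hm i⟩

theorem measurePreserving_torusLift (k : Fin d → ℤ) :
    MeasurePreserving (torusLift k) volume (volume.restrict (unitCube k)) := by
  have h₁ := UnitAddTorus.measurePreserving_equivPiIoc (fun i => (k i : ℝ))
  have h₂ := measurePreserving_subtype_coe (μa := (volume : Measure (Fin d → ℝ)))
    (s := {x : Fin d → ℝ | ∀ i, x i ∈ Set.Ioc (k i : ℝ) (k i + 1)})
    (MeasurableSet.univ_pi' (fun i => measurableSet_Ioc))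
  have h₃ := (PiLp.volume_preserving_toLp (Fin d)).restrict_preimage (measurableSet_unitCube k)
  exact (h₃.comp h₂).comp h₁

/-- The frequency is integral, so the choice of cube is immaterial; this lets `ψ` and `φ` be tested
on different cubes. -/
theorem mFourier_neg_eq_fourierChar (z : Fin d → ℤ) (t : UnitAddTorus (Fin d))
    (k : Fin d → ℤ) :
    UnitAddTorus.mFourier (-z) t = 𝐞 (-inner ℝ (intVec z) (torusLift k t)) := by
  have : UnitAddTorus.mFourier (-z) t =
      ∏ i, fourier (-z i) ((torusLift k t i : ℝ) : UnitAddCircle) := by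
    simp [UnitAddTorus.mFourier, coe_torusLift]
  rw [this]
  simp only [fourier_coe_apply, ← Complex.exp_sum, Real.fourierChar_apply]
  congr 1
  simp [intVec, PiLp.inner_apply, Finset.mul_sum, Finset.sum_mul]
  refine Finset.sum_congr rfl fun i _ => ?_
  ring

/-- Two lifts of `t` differ by an integer vector. If neither value vanished, the terms `0` and `m`
would put `torusLift k t` in both supports. -/
theorem ae_fourier_torusLift_eq_zero_or {ψ φ : L2 d}
    (h : volume (Function.support (periodization ψ) ∩ Function.support (periodization φ)) = 0)
    (k l : Fin d → ℤ) :
    ∀ᵐ t : UnitAddTorus (Fin d),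
      (𝓕 ψ : L2 d) (torusLift k t) = 0 ∨ (𝓕 φ : L2 d) (torusLift l t) = 0 := by
  have h₁ : ∀ᵐ ξ ∂(volume.restrict (unitCube k)),
      ξ ∉ Function.support (periodization ψ) ∩ Function.support (periodization φ) :=
    ae_restrict_of_ae (measure_eq_zero_iff_ae_notMem.1 h)
  filter_upwards [(measurePreserving_torusLift k).quasiMeasurePreserving.ae h₁] with t ht
  contrapose! ht
  obtain ⟨m, hm⟩ := exists_torusLift_eq_add k l t
  refine ⟨fun h₀ => ht.1 ?_, fun h₀ => ht.2 ?_⟩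
  · have := ENNReal.tsum_eq_zero.1 h₀ 0
    have h0 : intVec (0 : Fin d → ℤ) = 0 := by ext; simp [intVec]
    simpa [h0] using this
  · have := ENNReal.tsum_eq_zero.1 h₀ m
    simpa [hm] using this

/-- For a function supported on the cube `unitCube k`, the Fourier coefficients of its
periodization. -/
theorem exists_mFourierCoeff_eq_setIntegral (k : Fin d → ℤ) {s : Set (EuclideanSpace ℝ (Fin d))}
    (hs : MeasurableSet s) (hsk : s ⊆ unitCube k) (g : L2 d) :
    ∃ R : Lp ℂ 2 (volume : Measure (UnitAddTorus (Fin d))),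
      (∀ᵐ t, g (torusLift k t) = 0 → R t = 0) ∧
      ∀ z, UnitAddTorus.mFourierCoeff R z =
        ∫ ξ in s, 𝐞 (-inner ℝ (intVec z) ξ) • g ξ := by
  -- As `s` lies in one cube, the periodization of `s.indicator g` has a single term, so no
  -- convergence question arises.
  have hmem : MemLp (s.indicator g ∘ torusLift k) 2 volume :=
    (((Lp.memLp g).indicator hs).restrict _).comp_measurePreserving (measurePreserving_torusLift k)
  refine ⟨hmem.toLp _, ?_, fun z => ?_⟩
  · filter_upwards [hmem.coeFn_toLp] with t ht h
    rw [ht]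
    by_cases hts : torusLift k t ∈ s <;> simp [hts, h]
  · have h₁ : UnitAddTorus.mFourierCoeff (hmem.toLp _) z =
        ∫ t, (fun ξ => 𝐞 (-inner ℝ (intVec z) ξ) • s.indicator g ξ) (torusLift k t) := by
      refine integral_congr_ae ?_
      filter_upwards [hmem.coeFn_toLp] with t ht
      rw [ht, mFourier_neg_eq_fourierChar z t k]
      rfl
    have hmeas : AEStronglyMeasurable (fun ξ => 𝐞 (-inner ℝ (intVec z) ξ) • s.indicator g ξ)
        (volume.restrict (unitCube k)) := by
      refine AEStronglyMeasurable.smul (f := fun ξ => (𝐞 (-inner ℝ (intVec z) ξ) : Circle))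
        (Continuous.aestronglyMeasurable (by fun_prop)) ?_
      exact ((Lp.aestronglyMeasurable g).indicator hs).restrict
    have h₂ := integral_map (measurePreserving_torusLift k).measurable.aemeasurable
      (by rwa [(measurePreserving_torusLift k).map_eq])
    rw [(measurePreserving_torusLift k).map_eq] at h₂
    refine h₁.trans (h₂.symm.trans ?_)
    rw [← integral_indicator hs, ← integral_indicator (measurableSet_unitCube k)]
    congr 1 with ξ
    by_cases h : ξ ∈ s
    · simp [h, hsk h]
    · by_cases h' : ξ ∈ unitCube k <;> simp [h, h']

/-- Parseval on the torus: the sum equals `∫ conj Q * R`, and almost everywhere one of the factors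
vanishes. -/
theorem tsum_inner_translation_eq_zero_of_cube {ψ φ : L2 d}
    (h : volume (Function.support (periodization ψ) ∩ Function.support (periodization φ)) = 0)
    {k l : Fin d → ℤ} {s t : Set (EuclideanSpace ℝ (Fin d))}
    (hs : MeasurableSet s) (hμs : volume s ≠ ∞) (hsk : s ⊆ unitCube k)
    (ht : MeasurableSet t) (hμt : volume t ≠ ∞) (htl : t ⊆ unitCube l) :
    ∑' z, inner ℂ (translation (intVec z) φ) (𝓕⁻ (indicatorConstLp 2 ht hμt (1 : ℂ)) : L2 d) *
      inner ℂ (𝓕⁻ (indicatorConstLp 2 hs hμs (1 : ℂ)) : L2 d) (translation (intVec z) ψ) = 0 := by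
  obtain ⟨R, hR, hRz⟩ := exists_mFourierCoeff_eq_setIntegral k hs hsk (𝓕 ψ)
  obtain ⟨Q, hQ, hQz⟩ := exists_mFourierCoeff_eq_setIntegral l ht htl (𝓕 φ)
  have key : ∀ {s : Set (EuclideanSpace ℝ (Fin d))} (hs : MeasurableSet s) (hμs : volume s ≠ ∞)
      (f : L2 d) (z : Fin d → ℤ),
      inner ℂ (𝓕⁻ (indicatorConstLp 2 hs hμs (1 : ℂ)) : L2 d) (translation (intVec z) f) =
        ∫ ξ in s, 𝐞 (-inner ℝ (intVec z) ξ) • (𝓕 f : L2 d) ξ := by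
    intro s hs hμs f z
    rw [← Lp.inner_fourier_eq, FourierTransform.fourier_fourierInv_eq,
      inner_indicatorConstLp_fourier_translation]
  have hsum := (UnitAddTorus.hasSum_prod_mFourierCoeff Q R).tsum_eq
  have hzero : ∫ t, conj (Q t) * R t = 0 := by
    refine integral_eq_zero_of_ae ?_
    filter_upwards [hR, hQ, ae_fourier_torusLift_eq_zero_or h k l] with t h₁ h₂ h₃
    rcases h₃ with h₃ | h₃
    · simp [h₁ h₃]
    · simp [h₂ h₃]
  rw [hzero] at hsum
  rw [← hsum]
  refine tsum_congr fun z => ?_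
  rw [hRz, hQz, ← key hs hμs, ← key ht hμt, inner_conj_symm]

/-- Cutting a set of finite measure along the cubes shows that `𝓕 f` integrates to zero over it. -/
theorem eq_zero_of_forall_inner_fourierInv_indicator {f : L2 d}
    (h : ∀ (k : Fin d → ℤ) (s : Set (EuclideanSpace ℝ (Fin d))) (hs : MeasurableSet s)
      (hμs : volume s ≠ ∞), s ⊆ unitCube k →
        inner ℂ (𝓕⁻ (indicatorConstLp 2 hs hμs (1 : ℂ)) : L2 d) f = 0) : f = 0 := by
  suffices h0 : (𝓕 f : L2 d) = 0 from
    (Lp.fourierTransformₗᵢ _ ℂ).map_eq_zero_iff.1 h0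
  have hint : ∀ s : Set (EuclideanSpace ℝ (Fin d)), MeasurableSet s → volume s < ∞ →
      IntegrableOn (𝓕 f : L2 d) s volume := fun s _ hμs =>
    integrableOn_Lp_of_measure_ne_top _ (by norm_num) hμs.ne
  rw [Lp.eq_zero_iff_ae_eq_zero]
  refine ae_eq_zero_of_forall_setIntegral_eq_of_sigmaFinite hint fun s hs hμs => ?_
  have hunion : s = ⋃ k : Fin d → ℤ, s ∩ unitCube k := by
    rw [← Set.inter_iUnion, iUnion_unitCube, Set.inter_univ]
  have hint' := hint s hs hμs
  rw [hunion] at hint' ⊢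
  rw [integral_iUnion (fun k => hs.inter (measurableSet_unitCube k))
    (fun k l hkl => (pairwise_disjoint_unitCube hkl).mono Set.inter_subset_right
      Set.inter_subset_right) hint']
  refine (tsum_congr fun k => ?_).trans tsum_zero
  have hμk : volume (s ∩ unitCube k) ≠ ∞ := ne_top_of_le_ne_top hμs.ne
    (measure_mono Set.inter_subset_left)
  have := h k _ (hs.inter (measurableSet_unitCube k)) hμk Set.inter_subset_right
  rwa [← Lp.inner_fourier_eq, FourierTransform.fourier_fourierInv_eq,
    L2.inner_indicatorConstLp_one] at this

/-- Bessel systems of integer translates are strongly disjoint when the supports of the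
periodizations of their generators are. -/
theorem stronglyDisjoint_translation {ψ φ : L2 d}
    (hψ : IsBessel fun z : Fin d → ℤ => translation (intVec z) ψ)
    (hφ : IsBessel fun z : Fin d → ℤ => translation (intVec z) φ)
    (h : volume (Function.support (periodization ψ) ∩ Function.support (periodization φ)) = 0) :
    StronglyDisjoint (fun z : Fin d → ℤ => translation (intVec z) ψ)
      (fun z : Fin d → ℤ => translation (intVec z) φ) := by
  refine ⟨hψ, hφ, ?_⟩
  rw [Submodule.isOrtho_iff_inner_eq]
  rintro _ ⟨u, rfl⟩ _ ⟨v, rfl⟩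
  -- Adjoints of the bounded analysis operators isolate one vector at a time, so `u` and then `v`
  -- may be replaced by cube-supported test functions.
  rw [← analysisCLM_apply, ← analysisCLM_apply, ← ContinuousLinearMap.adjoint_inner_right]
  suffices h₀ : (analysisCLM _ hψ).adjoint (analysisCLM _ hφ v) = 0 by rw [h₀, inner_zero_right]
  refine eq_zero_of_forall_inner_fourierInv_indicator fun k s hs hμs hsk => ?_
  rw [ContinuousLinearMap.adjoint_inner_right, ← ContinuousLinearMap.adjoint_inner_left]
  suffices h₀ : (analysisCLM _ hφ).adjoint
      (analysisCLM _ hψ (𝓕⁻ (indicatorConstLp 2 hs hμs (1 : ℂ)) : L2 d)) = 0 by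
    rw [h₀, inner_zero_left]
  refine eq_zero_of_forall_inner_fourierInv_indicator fun l t ht hμt htl => ?_
  rw [ContinuousLinearMap.adjoint_inner_right, ← inner_conj_symm, analysisCLM_apply,
    analysisCLM_apply, inner_analysis,
    tsum_inner_translation_eq_zero_of_cube h hs hμs hsk ht hμt htl, map_zero]

end Fourier

/-! ### Dilations, their commutation with translations, and adjoints -/

section Dilation

variable {d : ℕ}

/-- The linear map of `ℝᵈ` given by an invertible matrix. -/
abbrev lin (B : GL (Fin d) ℝ) : EuclideanSpace ℝ (Fin d) →ₗ[ℝ] EuclideanSpace ℝ (Fin d) :=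
  Matrix.toEuclideanLin (B : Matrix (Fin d) (Fin d) ℝ)

theorem lin_mul_apply (B C : GL (Fin d) ℝ) (x : EuclideanSpace ℝ (Fin d)) :
    lin (B * C) x = lin B (lin C x) := by
  simp [lin, Matrix.toLpLin_apply, Matrix.mulVec_mulVec]

theorem lin_one_apply (x : EuclideanSpace ℝ (Fin d)) :
    lin (1 : GL (Fin d) ℝ) x = x := by
  simp [lin]

theorem continuous_lin (B : GL (Fin d) ℝ) : Continuous (lin B) :=
  (lin B).continuous_of_finiteDimensional

theorem map_lin_volume (B : GL (Fin d) ℝ) :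
    Measure.map (lin B) (volume : Measure (EuclideanSpace ℝ (Fin d))) =
      ENNReal.ofReal |(B : Matrix (Fin d) (Fin d) ℝ).det⁻¹| • volume := by
  have h : LinearMap.det (lin B) = (B : Matrix (Fin d) (Fin d) ℝ).det := by
    simp only [lin, Matrix.toEuclideanLin]
    rw [Matrix.toLpLin_eq_toLin, LinearMap.det_toLin]
  rw [← h]
  refine Measure.map_linearMap_addHaar_eq_smul_addHaar _ ?_
  rw [h]
  exact (Matrix.isUnits_det_units B).ne_zero

theorem quasiMeasurePreserving_lin (B : GL (Fin d) ℝ) :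
    Measure.QuasiMeasurePreserving (lin B)
      (volume : Measure (EuclideanSpace ℝ (Fin d))) volume := by
  refine ⟨(continuous_lin B).measurable, ?_⟩
  rw [map_lin_volume]
  exact Measure.smul_absolutelyContinuous

theorem coeFn_compMatrix (B : GL (Fin d) ℝ) (f : L2 d) :
    compMatrix B f =ᵐ[volume] fun x => f (lin B x) :=
  (memLp_comp_matrix B f).coeFn_toLp

theorem compMatrix_one (f : L2 d) : compMatrix 1 f = f := by
  refine Lp.ext ?_
  filter_upwards [coeFn_compMatrix 1 f] with x hx
  rw [hx, lin_one_apply]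

theorem dilation_one (f : L2 d) : dilation 1 f = f := by
  simp [dilation, compMatrix_one]

theorem translation_compMatrix (B : GL (Fin d) ℝ) (a : EuclideanSpace ℝ (Fin d)) (f : L2 d) :
    translation a (compMatrix B f) = compMatrix B (translation (lin B a) f) := by
  refine Lp.ext ?_
  filter_upwards [coeFn_translation a (compMatrix B f),
    (measurePreserving_sub_right (volume : Measure (EuclideanSpace ℝ (Fin d)))
      a).quasiMeasurePreserving.ae_eq_comp (coeFn_compMatrix B f),
    coeFn_compMatrix B (translation (lin B a) f),
    (quasiMeasurePreserving_lin B).ae_eq_comp (coeFn_translation (lin B a) f)]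
    with x h₁ h₂ h₃ h₄
  simp only [Function.comp_apply, map_sub] at h₁ h₂ h₃ h₄
  rw [h₁, h₂, h₃, h₄]

theorem translation_add (a b : EuclideanSpace ℝ (Fin d)) (f : L2 d) :
    translation (a + b) f = translation a (translation b f) := by
  refine Lp.ext ?_
  filter_upwards [coeFn_translation (a + b) f, coeFn_translation a (translation b f),
    (measurePreserving_sub_right (volume : Measure (EuclideanSpace ℝ (Fin d)))
      a).quasiMeasurePreserving.ae_eq_comp (coeFn_translation b f)] with x h₁ h₂ h₃
  simp only [Function.comp_apply] at h₁ h₂ h₃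
  rw [h₁, h₂, h₃, sub_sub]

/-- The substitution `y = Bx` shows that the adjoint is a multiple of composition with `B⁻¹`. -/
theorem exists_inner_compMatrix_eq (B : GL (Fin d) ℝ) (F : L2 d) :
    ∃ G : L2 d, ∀ f : L2 d, inner ℂ (compMatrix B f) F = inner ℂ f G := by
  refine ⟨((|(B : Matrix (Fin d) (Fin d) ℝ).det⁻¹| : ℝ) : ℂ) • compMatrix B⁻¹ F, fun f => ?_⟩
  rw [inner_smul_right, L2.inner_def, L2.inner_def]
  have h₁ : ∫ x, inner ℂ (compMatrix B f x) (F x) =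
      ∫ x, (fun y => inner ℂ (f y) (F (lin B⁻¹ y))) (lin B x) := by
    refine integral_congr_ae ?_
    filter_upwards [coeFn_compMatrix B f] with x hx
    rw [hx, ← lin_mul_apply, inv_mul_cancel, lin_one_apply]
  have h₂ : ∫ y, inner ℂ (f y) (compMatrix B⁻¹ F y) =
      ∫ y, inner ℂ (f y) (F (lin B⁻¹ y)) := by
    refine integral_congr_ae ?_
    filter_upwards [coeFn_compMatrix B⁻¹ F] with x hx
    rw [hx]
  have hmeas : AEStronglyMeasurable (fun y => inner ℂ (f y) (F (lin B⁻¹ y)))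
      (Measure.map (lin B) volume) := by
    refine AEStronglyMeasurable.mono_ac
      (quasiMeasurePreserving_lin B).absolutelyContinuous ?_
    exact (Lp.aestronglyMeasurable f).inner (memLp_comp_matrix B⁻¹ F).aestronglyMeasurable
  rw [h₁, h₂, ← integral_map (continuous_lin B).aemeasurable hmeas,
    map_lin_volume, integral_smul_measure, ENNReal.toReal_ofReal (abs_nonneg _),
    Complex.real_smul]

theorem exists_inner_smul_compMatrix_translation_eq (c : ℂ) (B : GL (Fin d) ℝ)
    (a : EuclideanSpace ℝ (Fin d)) (F : L2 d) :
    ∃ G : L2 d, ∀ f : L2 d, inner ℂ (c • compMatrix B (translation a f)) F = inner ℂ f G := by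
  obtain ⟨G, hG⟩ := exists_inner_compMatrix_eq B F
  refine ⟨(translationₗᵢ a).toContinuousLinearMap.adjoint (conj c • G), fun f => ?_⟩
  rw [ContinuousLinearMap.adjoint_inner_right, inner_smul_left, hG, inner_smul_right]
  rfl

end Dilation

/-- Summability allows grouping by cosets of the range of `σ`; injectivity makes `w ↦ σ w + r` a
bijection onto the coset of `r`. -/
theorem tsum_eq_zero_of_tsum_coset_eq_zero {G : Type*} [AddCommGroup G] {σ : G →+ G}
    (hσ : Function.Injective σ) {h : G → ℂ} (hs : Summable h)
    (h₀ : ∀ r, ∑' w, h (σ w + r) = 0) : ∑' z, h z = 0 := by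
  let e := Equiv.sigmaFiberEquiv (QuotientAddGroup.mk : G → G ⧸ σ.range)
  have hs' : Summable fun p => h (e p) := e.summable_iff.2 hs
  rw [← e.tsum_eq, hs'.tsum_sigma]
  refine (tsum_congr fun q => ?_).trans tsum_zero
  obtain ⟨r, rfl⟩ := QuotientAddGroup.mk_surjective q
  have hmem : ∀ w, (QuotientAddGroup.mk (σ w + r) : G ⧸ σ.range) = QuotientAddGroup.mk r := by
    intro w
    rw [eq_comm, QuotientAddGroup.eq]
    exact ⟨w, by abel⟩
  let i : G ≃ {z : G // (QuotientAddGroup.mk z : G ⧸ σ.range) = QuotientAddGroup.mk r} :=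
    Equiv.ofBijective (fun w => ⟨σ w + r, hmem w⟩) ⟨fun w w' hw => by
      simpa [hσ.eq_iff] using hw, fun ⟨z, hz⟩ => by
        obtain ⟨w, hw⟩ := QuotientAddGroup.eq.1 hz.symm
        exact ⟨w, Subtype.ext (by simp [hw])⟩⟩
  rw [← i.tsum_eq]
  exact h₀ r

/-! ### Integral matrices acting on the lattice -/

section Lattice

variable {d : ℕ}

theorem intVec_injective : Function.Injective (intVec (d := d)) := fun z w h => by
  funext i
  have := congrArg (fun x : EuclideanSpace ℝ (Fin d) => x i) h
  simpa [intVec] using this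

theorem intVec_add (z w : Fin d → ℤ) : intVec (z + w) = intVec z + intVec w := by
  ext; simp [intVec]

theorem PreservesIntegers.mul {A B : GL (Fin d) ℝ} (hA : PreservesIntegers A)
    (hB : PreservesIntegers B) : PreservesIntegers (A * B) := fun z => by
  obtain ⟨w, hw⟩ := hB z
  obtain ⟨v, hv⟩ := hA w
  exact ⟨v, by rw [lin_mul_apply, hw, hv]⟩

theorem PreservesIntegers.pow {A : GL (Fin d) ℝ} (hA : PreservesIntegers A) (N : ℕ) :
    PreservesIntegers (A ^ N) := by
  induction N with
  | zero => exact fun z => ⟨z, by rw [pow_zero, lin_one_apply]⟩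
  | succ N ih => rw [pow_succ]; exact ih.mul hA

/-- The endomorphism of `ℤᵈ` induced by the inverse of `B`, if that matrix is integral. -/
theorem PreservesIntegers.exists_addMonoidHom {B : GL (Fin d) ℝ} (hB : PreservesIntegers B⁻¹) :
    ∃ σ : (Fin d → ℤ) →+ (Fin d → ℤ), Function.Injective σ ∧ ∀ z,
      lin B (intVec (σ z)) = intVec z := by
  choose σ hσ using hB
  have hσ' : ∀ z, lin B (intVec (σ z)) =
      intVec z := fun z => by
    rw [← hσ, ← lin_mul_apply, mul_inv_cancel, lin_one_apply]
  refine ⟨AddMonoidHom.mk' σ fun z w => intVec_injective ?_, fun z w h => intVec_injective ?_, hσ'⟩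
  · rw [intVec_add, ← hσ, ← hσ, ← hσ, intVec_add, map_add]
  · rw [← hσ' z, ← hσ' w]
    exact congrArg _ (congrArg _ h)

end Lattice

/-! ### Reduction of every scale to integer translates -/

section QuasiAffine

variable {d n : ℕ} {A : GL (Fin d) ℝ} {Ψ Φ : Fin n → L2 d}

theorem quasiAffine_zero (j : Fin n) (z : Fin d → ℤ) :
    quasiAffine A Ψ (j, 0, z) = translation (intVec z) (Ψ j) := by
  simp [quasiAffine, dilation_one]

theorem IsBessel.translation_of_quasiAffine (h : IsBessel (quasiAffine A Ψ)) (j : Fin n) :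
    IsBessel fun z : Fin d → ℤ => translation (intVec z) (Ψ j) := by
  have := h.comp_injective (e := fun z : Fin d → ℤ => (j, (0 : ℤ), z))
    fun z w hzw => by simpa using hzw
  simpa only [Function.comp_def, quasiAffine_zero] using this

theorem quasiAffine_of_nonneg {m : ℤ} (hm : 0 ≤ m) (j : Fin n) (z : Fin d → ℤ) :
    quasiAffine A Ψ (j, m, z) = dilation (A ^ m) (translation (intVec z) (Ψ j)) :=
  if_pos hm

theorem quasiAffine_of_neg {m : ℤ} (hm : m < 0) (j : Fin n) (z : Fin d → ℤ) :
    quasiAffine A Ψ (j, m, z) =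
      ((|((A ^ m : GL (Fin d) ℝ) : Matrix (Fin d) (Fin d) ℝ).det| : ℝ) : ℂ) •
        compMatrix (A ^ m) (translation (lin (A ^ m) (intVec z)) (Ψ j)) := by
  rw [← translation_compMatrix, ← translationₗᵢ_apply, ← map_smul]
  exact if_neg hm.not_ge

/-- The outer operator is the same for all `z`, so its adjoint moves onto `F` and `G`. The shift `a`
need not be integral, as negative scales require. -/
theorem tsum_inner_smul_compMatrix_translation {ψ φ : L2 d}
    (h : StronglyDisjoint (fun z : Fin d → ℤ => translation (intVec z) ψ)
      (fun z : Fin d → ℤ => translation (intVec z) φ))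
    (c : ℂ) (B : GL (Fin d) ℝ) (a : EuclideanSpace ℝ (Fin d)) (F G : L2 d) :
    ∑' z : Fin d → ℤ,
      inner ℂ (c • compMatrix B (translation a (translation (intVec z) φ))) G *
      inner ℂ F (c • compMatrix B (translation a (translation (intVec z) ψ))) = 0 := by
  obtain ⟨hψ, hφ, h⟩ := h
  obtain ⟨F', hF⟩ := exists_inner_smul_compMatrix_translation_eq c B a F
  obtain ⟨G', hG⟩ := exists_inner_smul_compMatrix_translation_eq c B a G
  rw [Submodule.isOrtho_iff_inner_eq] at h
  have := h _ ⟨F', rfl⟩ _ ⟨G', rfl⟩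
  rw [inner_analysis] at this
  rw [← this]
  refine tsum_congr fun z => ?_
  rw [hG, ← inner_conj_symm F, hF, inner_conj_symm]

theorem stronglyDisjoint_quasiAffine (hint : PreservesIntegers A)
    (hΨ : IsBessel (quasiAffine A Ψ)) (hΦ : IsBessel (quasiAffine A Φ))
    (hdisj : ∀ j : Fin n, volume
      (Function.support (periodization (Ψ j)) ∩ Function.support (periodization (Φ j))) = 0) :
    StronglyDisjoint (quasiAffine A Ψ) (quasiAffine A Φ) := by
  refine stronglyDisjoint_of_tsum_eq_zero hΨ hΦ fun F G => ?_
  have hsum := (hasSum_inner_analysis hΨ hΦ F G).summable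
  rw [hsum.tsum_prod]
  refine (tsum_congr fun j => ?_).trans tsum_zero
  have hj := hsum.prod_factor j
  rw [hj.tsum_prod]
  refine (tsum_congr fun m => ?_).trans tsum_zero
  have hjm := hj.prod_factor m
  have hd := stronglyDisjoint_translation (hΨ.translation_of_quasiAffine j)
    (hΦ.translation_of_quasiAffine j) (hdisj j)
  rcases le_or_gt 0 m with hm | hm
  -- No shift is needed at nonnegative scales, so `a` is `intVec 0`.
  · have := tsum_inner_smul_compMatrix_translation hd
      ((Real.sqrt |((A ^ m : GL (Fin d) ℝ) : Matrix (Fin d) (Fin d) ℝ).det| : ℝ) : ℂ)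
      (A ^ m) (intVec 0) F G
    simpa only [dilation, ← translation_add, ← intVec_add, zero_add,
      quasiAffine_of_nonneg hm] using this
  · have hB : PreservesIntegers (A ^ m)⁻¹ := by
      obtain ⟨N, hN⟩ := Int.eq_ofNat_of_zero_le (neg_nonneg.2 hm.le)
      rw [← zpow_neg, hN, zpow_natCast]
      exact hint.pow N
    obtain ⟨σ, hσ, hσB⟩ := hB.exists_addMonoidHom
    refine tsum_eq_zero_of_tsum_coset_eq_zero hσ hjm fun r => ?_
    -- On the coset of `r`, `A^m (σ w + r) = w + A^m r`: integer translates followed by the fixed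
    -- shift `A^m r`.
    simp_rw [quasiAffine_of_neg hm, intVec_add, map_add, hσB, add_comm (intVec _),
      translation_add]
    exact tsum_inner_smul_compMatrix_translation hd _ _ _ F G

end QuasiAffine

end QuasiAffine

end

theorem mainTheorem9 (d n : ℕ) (A : GL (Fin d) ℝ)
    (hexp : QuasiAffine.IsExpansive A) (hint : QuasiAffine.PreservesIntegers A)
    (Ψ Φ : Fin n → QuasiAffine.L2 d)
    (hΨ : QuasiAffine.IsFrame (QuasiAffine.quasiAffine A Ψ))
    (hΦ : QuasiAffine.IsFrame (QuasiAffine.quasiAffine A Φ))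
    (hdisj : ∀ j : Fin n, MeasureTheory.volume
      (Function.support (QuasiAffine.periodization (Ψ j)) ∩
        Function.support (QuasiAffine.periodization (Φ j))) = 0) :
    QuasiAffine.StronglyDisjoint (QuasiAffine.quasiAffine A Ψ) (QuasiAffine.quasiAffine A Φ) ∧
      QuasiAffine.HasDirectSumFrame (QuasiAffine.quasiAffine A Ψ)
        (QuasiAffine.quasiAffine A Φ) := by
  have h := QuasiAffine.stronglyDisjoint_quasiAffine hint hΨ.isBessel hΦ.isBessel hdisj
  exact ⟨h, h.hasDirectSumFrame hΨ hΦ⟩
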